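/- Let $n \ge 1$ and let $f:[0,1]^n \to [0,\infty)$ be a nonnegative function such that $f^{1/n}$ is Lipschitz continuous on $[0,1]^n$. Write $\Gamma = \partial[0,1]^n \setminus (0,1]^n$, $a_+ = \max(a,0)$, and $[g]_{1;\Omega} = \sup_{x,y\in\Omega,\, x\neq y} |g(x)-g(y)|/|x-y|$ with the Euclidean norm $|\cdot|$. Viscosity sub- and supersolutions on $(0,1]^n$ are understood with $C^1$ test functions and local maxima, respectively minima, taken relative to $(0,1]^n$. Let $u \in C([0,1]^n)$ be the viscosity solution, nondecreasing in each variable, of $$ (u_{x_1})_+ \cdots (u_{x_n})_+ = f \ \text{ in } (0,1]^n, \qquad u = 0 \ \text{ on } \Gamma, \tag{P1}$$ and let $$ w(x) = \frac{u(x)}{n (x_1\cdots x_n)^{1/n}}, \qquad x \in (0,1]^n .$$ Then $w$ is the maximal bounded viscosity solution of $$ \prod_{i=1}^n (w + n x_i w_{x_i})_+ = f \ \text{ on } (0,1]^n \tag{P3}$$ (it is a bounded viscosity solution, and every bounded viscosity solution $z$ of (P3) satisfies $z \le w$ on $(0,1]^n$). Moreover $w$ extends to a Lipschitz continuous function on $[0,1]^n$,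 and this extension, still denoted $w$, satisfies $$ [w]_{1;[0,1]^n} \le \sqrt{n}\, [f^{1/n}]_{1;[0,1]^n}. $$ -/

import Mathlib

open scoped NNReal ENNReal

noncomputable section

/-- The closed cube `[0,1]^n` in Euclidean space. -/
def closedCube (n : ℕ) : Set (EuclideanSpace ℝ (Fin n)) :=
  {x | ∀ i, 0 ≤ x i ∧ x i ≤ 1}

/-- The half-open cube `(0,1]^n`. -/
def halfOpenCube (n : ℕ) : Set (EuclideanSpace ℝ (Fin n)) :=
  {x | ∀ i, 0 < x i ∧ x i ≤ 1}

/-- The part `Γ = ∂[0,1]^n \ (0,1]^n` of the boundary of the cube: the points of `[0,1]^n` with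
some coordinate equal to `0`. (The interior of `[0,1]^n` lies in `(0,1]^n`, so the boundary may be
replaced by the closed cube here.) -/
def cubeGamma (n : ℕ) : Set (EuclideanSpace ℝ (Fin n)) :=
  closedCube n \ halfOpenCube n

/-- The gradient `(φ_{x_1}, …, φ_{x_n})` at `x`, as a tuple of partial derivatives. -/
def partials {n : ℕ} (φ : EuclideanSpace ℝ (Fin n) → ℝ) (x : EuclideanSpace ℝ (Fin n)) :
    Fin n → ℝ :=
  fun i => fderiv ℝ φ x (EuclideanSpace.single i 1)

/-- `u` is a viscosity subsolution of `H(x, u, Du) = 0` on `Ω` (with the sign convention that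
`p ↦ H(x, z, p)` is nondecreasing): `u` is upper semicontinuous on `Ω`, and `H(x₀, u(x₀), Dφ(x₀)) ≤ 0`
whenever `φ` is `C¹` near `x₀ ∈ Ω` and `u - φ` has a local maximum at `x₀` relative to `Ω`. -/
def IsViscositySubsolution {n : ℕ} (Ω : Set (EuclideanSpace ℝ (Fin n)))
    (H : EuclideanSpace ℝ (Fin n) → ℝ → (Fin n → ℝ) → ℝ)
    (u : EuclideanSpace ℝ (Fin n) → ℝ) : Prop :=
  UpperSemicontinuousOn u Ω ∧
    ∀ x₀ ∈ Ω, ∀ φ : EuclideanSpace ℝ (Fin n) → ℝ, ContDiffAt ℝ 1 φ x₀ →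
      IsLocalMaxOn (fun x => u x - φ x) Ω x₀ → H x₀ (u x₀) (partials φ x₀) ≤ 0

/-- `u` is a viscosity supersolution of `H(x, u, Du) = 0` on `Ω`: `u` is lower semicontinuous on
`Ω`, and `H(x₀, u(x₀), Dφ(x₀)) ≥ 0` whenever `φ` is `C¹` near `x₀ ∈ Ω` and `u - φ` has a local
minimum at `x₀` relative to `Ω`. -/
def IsViscositySupersolution {n : ℕ} (Ω : Set (EuclideanSpace ℝ (Fin n)))
    (H : EuclideanSpace ℝ (Fin n) → ℝ → (Fin n → ℝ) → ℝ)
    (u : EuclideanSpace ℝ (Fin n) → ℝ) : Prop :=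
  LowerSemicontinuousOn u Ω ∧
    ∀ x₀ ∈ Ω, ∀ φ : EuclideanSpace ℝ (Fin n) → ℝ, ContDiffAt ℝ 1 φ x₀ →
      IsLocalMinOn (fun x => u x - φ x) Ω x₀ → 0 ≤ H x₀ (u x₀) (partials φ x₀)

/-- A viscosity solution is a viscosity subsolution and a viscosity supersolution
(in particular it is continuous on `Ω`). -/
def IsViscositySolution {n : ℕ} (Ω : Set (EuclideanSpace ℝ (Fin n)))
    (H : EuclideanSpace ℝ (Fin n) → ℝ → (Fin n → ℝ) → ℝ)
    (u : EuclideanSpace ℝ (Fin n) → ℝ) : Prop :=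
  IsViscositySubsolution Ω H u ∧ IsViscositySupersolution Ω H u

/-- The operator of `(u_{x_1})_+ ⋯ (u_{x_n})_+ = f`. -/
def hamiltonianP1 {n : ℕ} (f : EuclideanSpace ℝ (Fin n) → ℝ) :
    EuclideanSpace ℝ (Fin n) → ℝ → (Fin n → ℝ) → ℝ :=
  fun x _ p => (∏ i, max (p i) 0) - f x

/-- The operator of `∏ᵢ (w + n xᵢ w_{x_i})_+ = f`. -/
def hamiltonianP3 {n : ℕ} (f : EuclideanSpace ℝ (Fin n) → ℝ) :
    EuclideanSpace ℝ (Fin n) → ℝ → (Fin n → ℝ) → ℝ :=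
  fun x z p => (∏ i, max (z + (n : ℝ) * x i * p i) 0) - f x

/-- `u` is a nondecreasing viscosity solution on `[0,1]^n` of
`(u_{x_1})_+ ⋯ (u_{x_n})_+ = f` in `(0,1]^n`, `u = 0` on `Γ`. -/
structure IsNondecreasingSolutionP1 {n : ℕ} (f u : EuclideanSpace ℝ (Fin n) → ℝ) : Prop where
  continuousOn : ContinuousOn u (closedCube n)
  nondecreasing : ∀ x ∈ closedCube n, ∀ y ∈ closedCube n, (∀ i, x i ≤ y i) → u x ≤ u y
  solution : IsViscositySolution (halfOpenCube n) (hamiltonianP1 f) u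
  boundary : ∀ x ∈ cubeGamma n, u x = 0

/-- `w` is a bounded viscosity solution of `∏ᵢ (w + n xᵢ w_{x_i})_+ = f` on `(0,1]^n`. -/
def IsBoundedSolutionP3 {n : ℕ} (f w : EuclideanSpace ℝ (Fin n) → ℝ) : Prop :=
  (∃ C : ℝ, ∀ x ∈ halfOpenCube n, |w x| ≤ C) ∧
    IsViscositySolution (halfOpenCube n) (hamiltonianP3 f) w

/-- `w` is the largest bounded viscosity solution of `∏ᵢ (w + n xᵢ w_{x_i})_+ = f` on `(0,1]^n`. -/
def IsMaximalBoundedSolutionP3 {n : ℕ} (f w : EuclideanSpace ℝ (Fin n) → ℝ) : Prop :=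
  IsBoundedSolutionP3 f w ∧
    ∀ z : EuclideanSpace ℝ (Fin n) → ℝ, IsBoundedSolutionP3 f z → ∀ x ∈ halfOpenCube n, z x ≤ w x

/-- The Lipschitz seminorm `[g]_{1;Ω} = sup_{x, y ∈ Ω, x ≠ y} |g(x) - g(y)| / |x - y|`, with
values in `[0, ∞]`; the terms with `x = y` are `0 / 0 = 0` and do not contribute. -/
def lipSeminorm {n : ℕ} (Ω : Set (EuclideanSpace ℝ (Fin n)))
    (g : EuclideanSpace ℝ (Fin n) → ℝ) : ℝ≥0∞ :=
  ⨆ x ∈ Ω, ⨆ y ∈ Ω, edist (g x) (g y) / edist x y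

end

/-! Multiplication by `n * (x₁ ⋯ xₙ)^{1/n}` turns (P3) into (P1): the chain rule gives factors `(x₁
⋯ xₙ)^{1/n} / x i` whose product is 1. Hence `w` solves (P3), and monotonicity of `u` makes each
factor `w + n x i w_{x_i}` nonnegative in the viscosity sense from below.

Everything else follows from one estimate, `sub_le_mul_dist`: `z x - w y ≤ L * dist x y` for every
bounded solution `z`, where `L` is a Lipschitz constant of `f^{1/n}`. Taking `x = y` gives
maximality; taking `z = w` gives the Lipschitz bound, with `L` in place of `√n L`.

The estimate comes from doubling variables with penalty `α/2 |x - y|²` and a logarithmic barrier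
that keeps maximizers off `Γ`. Both test gradients contain `α (x - y)`, and weighting by `x i` and
`y i` leaves the favourable difference `n α (x i - y i)²`. So each factor at `x` exceeds the one at
`y` by at least `s = z x - w y - 2nδ`, and superadditivity of the geometric mean
(`add_pow_le_prod_add`) yields `f(y)^{1/n} + s ≤ f(x)^{1/n}`. -/

/-! ### Superadditivity of the geometric mean. -/

/-- AM-GM applied to the ratios `b i / (b i + s)` and to `s / (b i + s)`; the two arithmetic means
add up to 1. -/
theorem add_pow_le_prod_add {n : ℕ} (hn : n ≠ 0) {b : Fin n → ℝ} (hb : ∀ i, 0 ≤ b i) {s c : ℝ}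
    (hs : 0 < s) (hc : 0 ≤ c) (hcb : c ^ n ≤ ∏ i, b i) : (c + s) ^ n ≤ ∏ i, (b i + s) := by
  have hn' : (n : ℝ) ≠ 0 := Nat.cast_ne_zero.2 hn
  have hbs : ∀ i, 0 < b i + s := fun i => add_pos_of_nonneg_of_pos (hb i) hs
  have hw : ∑ _i : Fin n, (1 / n : ℝ) = 1 := by
    simp [hn']
  have hP : 0 < ∏ i, (b i + s) := Finset.prod_pos fun i _ => hbs i
  set G : ℝ := (∏ i, (b i + s)) ^ (1 / n : ℝ) with hG
  have hG0 : 0 < G := Real.rpow_pos_of_pos hP _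
  have hGn : G ^ n = ∏ i, (b i + s) := by
    rw [hG, ← Real.rpow_natCast, ← Real.rpow_mul hP.le, one_div_mul_cancel hn', Real.rpow_one]
  have key : ∀ d : Fin n → ℝ, (∀ i, 0 ≤ d i) → ∀ e : ℝ, 0 ≤ e → e ^ n ≤ ∏ i, d i →
      e / G ≤ ∑ i, (1 / n : ℝ) * (d i / (b i + s)) := by
    intro d hd e he hed
    have h := Real.geom_mean_le_arith_mean_weighted Finset.univ (fun _ => (1 / n : ℝ))
      (fun i => d i / (b i + s)) (fun _ _ => by positivity) hw
      (fun i _ => div_nonneg (hd i) (hbs i).le)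
    refine le_trans ?_ h
    rw [Real.finsetProd_rpow _ _ (fun i _ => div_nonneg (hd i) (hbs i).le),
      Finset.prod_div_distrib, Real.div_rpow (Finset.prod_nonneg fun i _ => hd i) hP.le]
    have he' : e = (e ^ n) ^ (1 / n : ℝ) := by
      rw [← Real.rpow_natCast, ← Real.rpow_mul he, mul_one_div_cancel hn', Real.rpow_one]
    gcongr
    rw [he']
    gcongr
  have h1 := key b hb c hc hcb
  have h2 := key (fun _ => s) (fun _ => hs.le) s hs.le (by simp)
  have h3 : (∑ i, (1 / n : ℝ) * (b i / (b i + s))) + ∑ i, (1 / n : ℝ) * (s / (b i + s)) = 1 := by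
    rw [← Finset.sum_add_distrib]
    refine Eq.trans ?_ hw
    refine Finset.sum_congr rfl fun i _ => ?_
    rw [← mul_add, ← add_div, div_self (hbs i).ne', mul_one]
  have h4 : (c + s) / G ≤ 1 := by rw [add_div]; linarith
  rw [← hGn]
  rw [div_le_one hG0] at h4
  gcongr

/-! ### Separable test functions and rescaling by the geometric mean. -/

theorem contDiffAt_sum_coord {n : ℕ} {h : Fin n → ℝ → ℝ} {x : EuclideanSpace ℝ (Fin n)}
    (hh : ∀ i, ContDiffAt ℝ 1 (h i) (x i)) :
    ContDiffAt ℝ 1 (fun y : EuclideanSpace ℝ (Fin n) => ∑ i, h i (y i)) x := by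
  refine ContDiffAt.sum fun i _ => ?_
  exact (hh i).comp x (EuclideanSpace.proj (𝕜 := ℝ) i).contDiff.contDiffAt

theorem partials_sum_coord {n : ℕ} {h : Fin n → ℝ → ℝ} {h' : Fin n → ℝ}
    {x : EuclideanSpace ℝ (Fin n)} (hh : ∀ i, HasDerivAt (h i) (h' i) (x i)) :
    partials (fun y : EuclideanSpace ℝ (Fin n) => ∑ i, h i (y i)) x = h' := by
  have hd : HasFDerivAt (fun y : EuclideanSpace ℝ (Fin n) => ∑ i, h i (y i))
      (∑ i, h' i • (EuclideanSpace.proj (𝕜 := ℝ) i : EuclideanSpace ℝ (Fin n) →L[ℝ] ℝ)) x :=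
    HasFDerivAt.fun_sum fun i _ =>
      (hh i).comp_hasFDerivAt x (EuclideanSpace.proj (𝕜 := ℝ) i).hasFDerivAt
  funext j
  rw [partials, hd.fderiv]
  simp

/-- The geometric mean `(x₁ ⋯ xₙ)^{1/n}` for positive coordinates, as the exponential of the mean of
the logarithms. -/
noncomputable def expMeanLog {n : ℕ} (x : EuclideanSpace ℝ (Fin n)) : ℝ :=
  Real.exp (∑ i, (1 / n : ℝ) * Real.log (x i))

theorem expMeanLog_pos {n : ℕ} (x : EuclideanSpace ℝ (Fin n)) : 0 < expMeanLog x :=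
  Real.exp_pos _

theorem expMeanLog_eq {n : ℕ} {x : EuclideanSpace ℝ (Fin n)} (hx : x ∈ halfOpenCube n) :
    expMeanLog x = (∏ i, x i) ^ (1 / (n : ℝ)) := by
  rw [expMeanLog, Real.rpow_def_of_pos (Finset.prod_pos fun i _ => (hx i).1),
    Real.log_prod fun i _ => (hx i).1.ne', ← Finset.mul_sum, mul_comm]

theorem expMeanLog_pow {n : ℕ} (hn : n ≠ 0) {x : EuclideanSpace ℝ (Fin n)}
    (hx : x ∈ halfOpenCube n) : expMeanLog x ^ n = ∏ i, x i := by
  rw [expMeanLog_eq hx, ← Real.rpow_natCast, ← Real.rpow_mul (Finset.prod_nonneg fun i _ => (hx i).1.le),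
    one_div_mul_cancel (Nat.cast_ne_zero.2 hn), Real.rpow_one]

/-- A test function for (P3) turned into a test function for (P1). -/
noncomputable def liftTest {n : ℕ} (φ : EuclideanSpace ℝ (Fin n) → ℝ) (x : EuclideanSpace ℝ (Fin n)) : ℝ :=
  n * expMeanLog x * φ x

theorem contDiffAt_expMeanLog {n : ℕ} {x : EuclideanSpace ℝ (Fin n)} (hx : x ∈ halfOpenCube n) :
    ContDiffAt ℝ 1 (expMeanLog (n := n)) x := by
  refine ContDiffAt.exp (contDiffAt_sum_coord (h := fun _ t => (1 / n : ℝ) * Real.log t)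
    fun i => ?_)
  exact contDiffAt_const.mul (Real.contDiffAt_log.2 (hx i).1.ne')

theorem partials_expMeanLog {n : ℕ} {x : EuclideanSpace ℝ (Fin n)} (hx : x ∈ halfOpenCube n)
    (i : Fin n) : partials (expMeanLog (n := n)) x i = expMeanLog x * ((1 / n : ℝ) * (x i)⁻¹) := by
  have h := partials_sum_coord (x := x) (h := fun _ t => (1 / n : ℝ) * Real.log t)
    (fun i => (Real.hasDerivAt_log (hx i).1.ne').const_mul _)
  have hd : DifferentiableAt ℝ
      (fun y : EuclideanSpace ℝ (Fin n) => ∑ i, (1 / n : ℝ) * Real.log (y i)) x :=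
    (contDiffAt_sum_coord (h := fun _ t => (1 / n : ℝ) * Real.log t) fun i =>
      contDiffAt_const.mul (Real.contDiffAt_log.2 (hx i).1.ne')).differentiableAt one_ne_zero
  have h2 := congrFun h i
  simp only [partials] at h2 ⊢
  have h3 : HasFDerivAt (expMeanLog (n := n)) _ x := hd.hasFDerivAt.exp
  rw [h3.fderiv, smul_apply, h2]
  rfl

theorem contDiffAt_liftTest {n : ℕ} {x : EuclideanSpace ℝ (Fin n)} (hx : x ∈ halfOpenCube n)
    {φ : EuclideanSpace ℝ (Fin n) → ℝ} (hφ : ContDiffAt ℝ 1 φ x) :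
    ContDiffAt ℝ 1 (liftTest φ) x :=
  (contDiffAt_const.mul (contDiffAt_expMeanLog hx)).mul hφ

theorem partials_liftTest {n : ℕ} (hn : n ≠ 0) {x : EuclideanSpace ℝ (Fin n)}
    (hx : x ∈ halfOpenCube n) {φ : EuclideanSpace ℝ (Fin n) → ℝ} (hφ : ContDiffAt ℝ 1 φ x)
    (i : Fin n) :
    partials (liftTest φ) x i = expMeanLog x / x i * (φ x + n * x i * partials φ x i) := by
  have h1 := partials_expMeanLog hx i
  have hd : HasFDerivAt (liftTest φ) _ x :=
    (((contDiffAt_expMeanLog hx).differentiableAt one_ne_zero).hasFDerivAt.const_mul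
      (n : ℝ)).mul (hφ.differentiableAt one_ne_zero).hasFDerivAt
  simp only [partials] at h1 ⊢
  rw [hd.fderiv]
  simp only [add_apply, smul_apply, smul_eq_mul, h1]
  have hn' : (n : ℝ) ≠ 0 := Nat.cast_ne_zero.2 hn
  have := (hx i).1.ne'
  field_simp
  ring

/-- The positive weights `expMeanLog x / x i` pass through the positive parts, and their product is
1. -/
theorem hamiltonianP1_liftTest {n : ℕ} (hn : n ≠ 0) {x : EuclideanSpace ℝ (Fin n)}
    (hx : x ∈ halfOpenCube n) {φ : EuclideanSpace ℝ (Fin n) → ℝ} (hφ : ContDiffAt ℝ 1 φ x)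
    (f : EuclideanSpace ℝ (Fin n) → ℝ) (r : ℝ) :
    hamiltonianP1 f x r (partials (liftTest φ) x) = hamiltonianP3 f x (φ x) (partials φ x) := by
  have h : ∀ i, max (partials (liftTest φ) x i) 0 =
      expMeanLog x / x i * max (φ x + n * x i * partials φ x i) 0 := fun i => by
    rw [partials_liftTest hn hx hφ,
      mul_max_of_nonneg _ _ (div_pos (expMeanLog_pos x) (hx i).1).le, mul_zero]
  have h1 : ∏ i, expMeanLog x / x i = 1 := by
    rw [Finset.prod_div_distrib, Finset.prod_const, Finset.card_univ, Fintype.card_fin,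
      expMeanLog_pow hn hx, div_self (Finset.prod_pos fun i _ => (hx i).1).ne']
  simp only [hamiltonianP1, hamiltonianP3]
  rw [Finset.prod_congr rfl fun i _ => h i, Finset.prod_mul_distrib, h1, one_mul]

/-! ### Comparison by doubling of variables. -/

/-- `hmono` is what singles out `w`: without it a negative factor at `y` could be hidden by the
positive part, and adding `s` to it would gain nothing. -/
theorem le_of_isMaxOn_doubling {n : ℕ} (hn : n ≠ 0) {f z w : EuclideanSpace ℝ (Fin n) → ℝ}
    (hf : ∀ x ∈ closedCube n, 0 ≤ f x)
    (hz : IsViscositySubsolution (halfOpenCube n) (hamiltonianP3 f) z)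
    (hw : IsViscositySupersolution (halfOpenCube n) (hamiltonianP3 f) w)
    (hmono : ∀ y ∈ halfOpenCube n, ∀ ψ : EuclideanSpace ℝ (Fin n) → ℝ, ContDiffAt ℝ 1 ψ y →
      IsLocalMinOn (fun x => w x - ψ x) (halfOpenCube n) y →
        ∀ i, 0 ≤ w y + n * y i * partials ψ y i)
    {α δ : ℝ} (hα : 0 ≤ α) {x y : EuclideanSpace ℝ (Fin n)}
    (hx : x ∈ halfOpenCube n) (hy : y ∈ halfOpenCube n)
    (hmax : ∀ x' ∈ halfOpenCube n, ∀ y' ∈ halfOpenCube n,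
      z x' - w y' - ∑ i, α / 2 * (x' i - y' i) ^ 2
          + δ * (∑ i, Real.log (x' i) + ∑ i, Real.log (y' i)) ≤
        z x - w y - ∑ i, α / 2 * (x i - y i) ^ 2
          + δ * (∑ i, Real.log (x i) + ∑ i, Real.log (y i)))
    (hs : 0 < z x - w y - 2 * n * δ) :
    f y ^ (1 / (n : ℝ)) + (z x - w y - 2 * n * δ) ≤ f x ^ (1 / (n : ℝ)) := by
  have hn' : (n : ℝ) ≠ 0 := Nat.cast_ne_zero.2 hn
  have hsub : ∀ x ∈ halfOpenCube n, x ∈ closedCube n := fun x h i => ⟨(h i).1.le, (h i).2⟩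
  have hpow : ∀ x ∈ halfOpenCube n, (f x ^ (1 / (n : ℝ))) ^ n = f x := fun x h => by
    rw [← Real.rpow_natCast, ← Real.rpow_mul (hf x (hsub x h)), one_div_mul_cancel hn',
      Real.rpow_one]
  have hnn : ∀ x ∈ halfOpenCube n, 0 ≤ f x ^ (1 / (n : ℝ)) := fun x h =>
    Real.rpow_nonneg (hf x (hsub x h)) _
  have hdx : ∀ i, HasDerivAt (fun t => α / 2 * (t - y i) ^ 2 - δ * Real.log t)
      (α * (x i - y i) - δ * (x i)⁻¹) (x i) := fun i => by
    have := ((((hasDerivAt_id (x i)).sub_const (y i)).pow 2).const_mul (α / 2)).sub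
      ((Real.hasDerivAt_log (hx i).1.ne').const_mul δ)
    refine this.congr_deriv ?_
    simp
    ring
  have hdy : ∀ i, HasDerivAt (fun t => -(α / 2 * (x i - t) ^ 2) + δ * Real.log t)
      (α * (x i - y i) + δ * (y i)⁻¹) (y i) := fun i => by
    have := ((((hasDerivAt_id (y i)).const_sub (x i)).pow 2).const_mul (α / 2)).neg.add
      ((Real.hasDerivAt_log (hy i).1.ne').const_mul δ)
    refine this.congr_deriv ?_
    simp
    ring
  have hcx : ContDiffAt ℝ 1 (fun x' : EuclideanSpace ℝ (Fin n) =>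
      ∑ i, (α / 2 * (x' i - y i) ^ 2 - δ * Real.log (x' i))) x :=
    contDiffAt_sum_coord (h := fun i t => α / 2 * (t - y i) ^ 2 - δ * Real.log t) fun i =>
      (contDiffAt_const.mul ((contDiffAt_id.sub contDiffAt_const).pow 2)).sub
        (contDiffAt_const.mul (Real.contDiffAt_log.2 (hx i).1.ne'))
  have hcy : ContDiffAt ℝ 1 (fun y' : EuclideanSpace ℝ (Fin n) =>
      ∑ i, (-(α / 2 * (x i - y' i) ^ 2) + δ * Real.log (y' i))) y :=
    contDiffAt_sum_coord (h := fun i t => -(α / 2 * (x i - t) ^ 2) + δ * Real.log t) fun i =>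
      (contDiffAt_const.mul ((contDiffAt_const.sub contDiffAt_id).pow 2)).neg.add
        (contDiffAt_const.mul (Real.contDiffAt_log.2 (hy i).1.ne'))
  have hmx : IsLocalMaxOn (fun x' => z x' -
      ∑ i, (α / 2 * (x' i - y i) ^ 2 - δ * Real.log (x' i))) (halfOpenCube n) x := by
    refine IsMaxOn.localize fun x' hx' => ?_
    have := hmax x' hx' y hy
    simp only [Set.mem_ofPred_eq, Finset.sum_sub_distrib, ← Finset.mul_sum] at this ⊢
    linarith
  have hmy : IsLocalMinOn (fun y' => w y' -
      ∑ i, (-(α / 2 * (x i - y' i) ^ 2) + δ * Real.log (y' i))) (halfOpenCube n) y := by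
    refine IsMinOn.localize fun y' hy' => ?_
    have := hmax x hx y' hy'
    simp only [Set.mem_ofPred_eq, Finset.sum_add_distrib, Finset.sum_neg_distrib,
      ← Finset.mul_sum] at this ⊢
    linarith
  have hX := hz.2 x hx _ hcx hmx
  have hY := hw.2 y hy _ hcy hmy
  have hB := hmono y hy _ hcy hmy
  rw [partials_sum_coord hdx] at hX
  rw [partials_sum_coord hdy] at hY hB
  simp only [hamiltonianP3, sub_nonpos, sub_nonneg] at hX hY
  rw [Finset.prod_congr rfl fun i _ => max_eq_left (hB i), ← hpow y hy] at hY
  have hM := add_pow_le_prod_add hn hB hs (hnn y hy) hY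
  refine le_of_pow_le_pow_left₀ hn (hnn x hx) (hM.trans ?_)
  rw [hpow x hx]
  refine le_trans (Finset.prod_le_prod (fun i _ => add_nonneg (hB i) hs.le) fun i _ => ?_) hX
  refine le_max_of_le_left ?_
  -- The weights cancel the derivative of `log`, so the barrier costs exactly `n * δ` at each of the
  -- two points, wherever they lie.
  have h1 : n * y i * (α * (x i - y i) + δ * (y i)⁻¹) = n * α * (y i * (x i - y i)) + n * δ := by
    have := (hy i).1.ne'
    field_simp
  have h2 : n * x i * (α * (x i - y i) - δ * (x i)⁻¹) = n * α * (x i * (x i - y i)) - n * δ := by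
    have := (hx i).1.ne'
    field_simp
  rw [h1, h2]
  have h3 : 0 ≤ n * α * (x i - y i) ^ 2 := by positivity
  linarith

theorem exists_doubling_max {n : ℕ} {z w : EuclideanSpace ℝ (Fin n) → ℝ}
    (hz : ContinuousOn z (halfOpenCube n)) (hw : ContinuousOn w (halfOpenCube n)) {C : ℝ}
    (hzC : ∀ x ∈ halfOpenCube n, |z x| ≤ C) (hwC : ∀ x ∈ halfOpenCube n, |w x| ≤ C)
    {α δ : ℝ} (hα : 0 ≤ α) (hδ : 0 < δ) {x₀ y₀ : EuclideanSpace ℝ (Fin n)}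
    (hx₀ : x₀ ∈ halfOpenCube n) (hy₀ : y₀ ∈ halfOpenCube n) :
    ∃ x ∈ halfOpenCube n, ∃ y ∈ halfOpenCube n, ∀ x' ∈ halfOpenCube n, ∀ y' ∈ halfOpenCube n,
      z x' - w y' - ∑ i, α / 2 * (x' i - y' i) ^ 2
          + δ * (∑ i, Real.log (x' i) + ∑ i, Real.log (y' i)) ≤
        z x - w y - ∑ i, α / 2 * (x i - y i) ^ 2
          + δ * (∑ i, Real.log (x i) + ∑ i, Real.log (y i)) := by
  set Φ : EuclideanSpace ℝ (Fin n) × EuclideanSpace ℝ (Fin n) → ℝ := fun p =>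
    z p.1 - w p.2 - ∑ i, α / 2 * (p.1 i - p.2 i) ^ 2
      + δ * (∑ i, Real.log (p.1 i) + ∑ i, Real.log (p.2 i)) with hΦ
  -- All logarithms are nonpositive, so each one is at least their total, and `Φ p ≥ Φ (x₀, y₀)`
  -- bounds that total below by the exponent here. Competitors thus lie in a compact cube away from
  -- `Γ`.
  set ε : ℝ := Real.exp ((Φ (x₀, y₀) - 2 * C) / δ) with hε
  have hε0 : 0 < ε := Real.exp_pos _
  set Q : Set (EuclideanSpace ℝ (Fin n)) := {x | ∀ i, ε ≤ x i ∧ x i ≤ 1} with hQ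
  have hQs : Q ⊆ halfOpenCube n := fun x h i => ⟨hε0.trans_le (h i).1, (h i).2⟩
  have hQc : IsCompact Q := by
    have h1 : IsCompact (Set.univ.pi fun _ : Fin n => Set.Icc ε 1) :=
      isCompact_univ_pi fun _ => isCompact_Icc
    have h2 := (EuclideanSpace.equiv (Fin n) ℝ).symm.toHomeomorph.isCompact_image.2 h1
    convert h2 using 1
    ext x
    constructor
    · intro h
      exact ⟨fun i => x i, fun i _ => h i, rfl⟩
    · rintro ⟨t, ht, rfl⟩ i
      exact ht i trivial
  have hlog : ∀ x ∈ halfOpenCube n, ∀ i, Real.log (x i) ≤ 0 := fun x h i =>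
    Real.log_nonpos (h i).1.le (h i).2
  have hin : ∀ p : EuclideanSpace ℝ (Fin n) × EuclideanSpace ℝ (Fin n),
      p.1 ∈ halfOpenCube n → p.2 ∈ halfOpenCube n → Φ (x₀, y₀) ≤ Φ p → p ∈ Q ×ˢ Q := by
    intro p h1 h2 hp
    have hq : 0 ≤ ∑ i, α / 2 * (p.1 i - p.2 i) ^ 2 := Finset.sum_nonneg fun i _ => by positivity
    have hz1 := (abs_le.1 (hzC p.1 h1)).2
    have hw1 := (abs_le.1 (hwC p.2 h2)).1
    have hsum : (Φ (x₀, y₀) - 2 * C) / δ ≤ ∑ i, Real.log (p.1 i) + ∑ i, Real.log (p.2 i) := by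
      rw [div_le_iff₀ hδ, mul_comm]
      have : Φ p = z p.1 - w p.2 - ∑ i, α / 2 * (p.1 i - p.2 i) ^ 2
        + δ * (∑ i, Real.log (p.1 i) + ∑ i, Real.log (p.2 i)) := rfl
      linarith
    have hle : ∀ x ∈ halfOpenCube n, ∀ i, ∑ j, Real.log (x j) ≤ Real.log (x i) := fun x h i => by
      rw [← Finset.add_sum_erase _ _ (Finset.mem_univ i)]
      have := Finset.sum_nonpos fun j (_ : j ∈ Finset.univ.erase i) => hlog x h j
      linarith
    have hle0 : ∀ x ∈ halfOpenCube n, ∑ j, Real.log (x j) ≤ 0 := fun x h =>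
      Finset.sum_nonpos fun j _ => hlog x h j
    refine ⟨fun i => ⟨?_, (h1 i).2⟩, fun i => ⟨?_, (h2 i).2⟩⟩
    · rw [hε, ← Real.le_log_iff_exp_le (h1 i).1]
      linarith [hle _ h1 i, hle0 _ h2]
    · rw [hε, ← Real.le_log_iff_exp_le (h2 i).1]
      linarith [hle _ h2 i, hle0 _ h1]
  have hm1 : Set.MapsTo Prod.fst (Q ×ˢ Q) (halfOpenCube n) := fun p hp => hQs hp.1
  have hm2 : Set.MapsTo Prod.snd (Q ×ˢ Q) (halfOpenCube n) := fun p hp => hQs hp.2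
  have hc : ContinuousOn Φ (Q ×ˢ Q) := by
    refine ContinuousOn.add (((hz.comp continuousOn_fst hm1).sub
      (hw.comp continuousOn_snd hm2)).sub (by fun_prop)) (continuousOn_const.mul
        (ContinuousOn.add ?_ ?_))
    · exact continuousOn_finsetSum _ fun i _ =>
        ContinuousOn.log (by fun_prop) fun p hp => (hQs hp.1 i).1.ne'
    · exact continuousOn_finsetSum _ fun i _ =>
        ContinuousOn.log (by fun_prop) fun p hp => (hQs hp.2 i).1.ne'
  obtain ⟨p, hp, hpm⟩ := (hQc.prod hQc).exists_isMaxOn ⟨_, hin (x₀, y₀) hx₀ hy₀ le_rfl⟩ hc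
  refine ⟨p.1, hQs hp.1, p.2, hQs hp.2, fun x' hx' y' hy' => ?_⟩
  change Φ (x', y') ≤ Φ p
  rcases le_total (Φ (x₀, y₀)) (Φ (x', y')) with h | h
  · exact hpm (hin (x', y') hx' hy' h)
  · exact h.trans (hpm (hin (x₀, y₀) hx₀ hy₀ le_rfl))

theorem sub_le_of_doubling {n : ℕ} (hn : n ≠ 0) {f z w : EuclideanSpace ℝ (Fin n) → ℝ}
    (hf : ∀ x ∈ closedCube n, 0 ≤ f x) {L : ℝ≥0}
    (hL : LipschitzOnWith L (fun x => f x ^ (1 / (n : ℝ))) (closedCube n))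
    (hz : IsBoundedSolutionP3 f z) (hw : IsBoundedSolutionP3 f w)
    (hmono : ∀ y ∈ halfOpenCube n, ∀ ψ : EuclideanSpace ℝ (Fin n) → ℝ, ContDiffAt ℝ 1 ψ y →
      IsLocalMinOn (fun x => w x - ψ x) (halfOpenCube n) y →
        ∀ i, 0 ≤ w y + n * y i * partials ψ y i)
    {α : ℝ} (hα : 0 < α) {x₀ y₀ : EuclideanSpace ℝ (Fin n)}
    (hx₀ : x₀ ∈ halfOpenCube n) (hy₀ : y₀ ∈ halfOpenCube n) :
    z x₀ - w y₀ ≤ α / 2 * dist x₀ y₀ ^ 2 + L ^ 2 / (2 * α) := by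
  by_contra! hcon
  have hsub : ∀ x ∈ halfOpenCube n, x ∈ closedCube n := fun x h i => ⟨(h i).1.le, (h i).2⟩
  have hdist : ∀ x y : EuclideanSpace ℝ (Fin n),
      ∑ i, α / 2 * (x i - y i) ^ 2 = α / 2 * dist x y ^ 2 := fun x y => by
    rw [← Finset.mul_sum, dist_eq_norm, EuclideanSpace.real_norm_sq_eq]
    rfl
  obtain ⟨⟨C, hC⟩, hzs⟩ := hz
  obtain ⟨⟨D, hD⟩, hws⟩ := hw
  have hlog0 : ∀ x ∈ halfOpenCube n, ∑ j, Real.log (x j) ≤ 0 := fun x h =>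
    Finset.sum_nonpos fun i _ => Real.log_nonpos (h i).1.le (h i).2
  -- `δ * A` is the whole cost of the barrier: `2nδ` in the equations and its value at `(x₀, y₀)`.
  -- The choice of `δ` makes it half of the excess `σ`.
  set A : ℝ := 2 * n - (∑ i, Real.log (x₀ i) + ∑ i, Real.log (y₀ i)) with hA
  have hA0 : 0 < A := by
    have : (0 : ℝ) < n := Nat.cast_pos.2 (Nat.pos_of_ne_zero hn)
    linarith [hlog0 _ hx₀, hlog0 _ hy₀]
  set σ : ℝ := z x₀ - w y₀ - (α / 2 * dist x₀ y₀ ^ 2 + L ^ 2 / (2 * α)) with hσ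
  have hσ0 : 0 < σ := sub_pos.2 hcon
  set δ : ℝ := σ / (2 * A) with hδ
  have hδ0 : 0 < δ := by positivity
  have hδA : δ * A = σ / 2 := by rw [hδ]; field_simp
  obtain ⟨x, hx, y, hy, hmax⟩ := exists_doubling_max
    (continuousOn_iff_lower_upperSemicontinuousOn.2 ⟨hzs.2.1, hzs.1.1⟩)
    (continuousOn_iff_lower_upperSemicontinuousOn.2 ⟨hws.2.1, hws.1.1⟩)
    (fun x hx => (hC x hx).trans (le_max_left C D))
    (fun x hx => (hD x hx).trans (le_max_right C D)) hα.le hδ0 hx₀ hy₀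
  have h0 := hmax x₀ hx₀ y₀ hy₀
  rw [hdist, hdist] at h0
  have hneg : δ * (∑ i, Real.log (x i) + ∑ i, Real.log (y i)) ≤ 0 :=
    mul_nonpos_of_nonneg_of_nonpos hδ0.le (by linarith [hlog0 _ hx, hlog0 _ hy])
  have hyoung : L * dist x y ≤ α / 2 * dist x y ^ 2 + L ^ 2 / (2 * α) := by
    have h : α / 2 * dist x y ^ 2 + L ^ 2 / (2 * α) - L * dist x y =
        (α * dist x y - L) ^ 2 / (2 * α) := by
      field_simp
      ring
    have : 0 ≤ (α * dist x y - L) ^ 2 / (2 * α) := by positivity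
    linarith
  have hAδ : δ * (∑ i, Real.log (x₀ i) + ∑ i, Real.log (y₀ i)) = 2 * n * δ - δ * A := by
    rw [hA]; ring
  have hs : L * dist x y < z x - w y - 2 * n * δ := by linarith
  have hs0 : 0 < z x - w y - 2 * n * δ := lt_of_le_of_lt (by positivity) hs
  have h1 := le_of_isMaxOn_doubling hn hf hzs.1 hws.2 hmono hα.le hx hy hmax hs0
  have h2 := hL.dist_le_mul x (hsub x hx) y (hsub y hy)
  rw [Real.dist_eq] at h2
  linarith [le_abs_self (f x ^ (1 / (n : ℝ)) - f y ^ (1 / (n : ℝ)))]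

theorem sub_le_mul_dist {n : ℕ} (hn : n ≠ 0) {f z w : EuclideanSpace ℝ (Fin n) → ℝ}
    (hf : ∀ x ∈ closedCube n, 0 ≤ f x) {L : ℝ≥0}
    (hL : LipschitzOnWith L (fun x => f x ^ (1 / (n : ℝ))) (closedCube n))
    (hz : IsBoundedSolutionP3 f z) (hw : IsBoundedSolutionP3 f w)
    (hmono : ∀ y ∈ halfOpenCube n, ∀ ψ : EuclideanSpace ℝ (Fin n) → ℝ, ContDiffAt ℝ 1 ψ y →
      IsLocalMinOn (fun x => w x - ψ x) (halfOpenCube n) y →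
        ∀ i, 0 ≤ w y + n * y i * partials ψ y i)
    {x y : EuclideanSpace ℝ (Fin n)} (hx : x ∈ halfOpenCube n) (hy : y ∈ halfOpenCube n) :
    z x - w y ≤ L * dist x y := by
  refine le_of_forall_pos_le_add fun ε hε => ?_
  have hd : 0 ≤ dist x y := dist_nonneg
  have hL0 : (0 : ℝ) ≤ L := L.2
  -- The optimal `α` is `L / dist x y`; the shift keeps it defined when `x = y` and costs at most
  -- `ε`. If `L = 0`, a small positive `α` is used instead.
  set d' : ℝ := dist x y + ε / (L + 1) with hd'
  have hd'0 : 0 < d' := by positivity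
  by_cases hL00 : (L : ℝ) = 0
  · have h := sub_le_of_doubling hn hf hL hz hw hmono (α := 2 * ε / (dist x y ^ 2 + 1))
      (by positivity) hx hy
    have h2 : 2 * ε / (dist x y ^ 2 + 1) / 2 * dist x y ^ 2 ≤ ε := by
      rw [div_div, div_mul_eq_mul_div, div_le_iff₀ (by positivity)]
      nlinarith [sq_nonneg (dist x y)]
    simp only [hL00] at h ⊢
    simp at h
    linarith
  · have hLp : (0 : ℝ) < L := lt_of_le_of_ne hL0 (Ne.symm hL00)
    have h := sub_le_of_doubling hn hf hL hz hw hmono (α := L / d') (by positivity) hx hy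
    have h1 : (L : ℝ) ^ 2 / (2 * (L / d')) = L * d' / 2 := by field_simp
    have h2 : L / d' / 2 * dist x y ^ 2 ≤ L * d' / 2 := by
      rw [div_div, div_mul_eq_mul_div, div_le_iff₀ (by positivity)]
      have : dist x y ^ 2 ≤ d' ^ 2 := by
        gcongr
        rw [hd']
        linarith [show (0:ℝ) ≤ ε / (L + 1) by positivity]
      nlinarith
    have h3 : L * (ε / (L + 1)) ≤ ε := by
      rw [mul_div_assoc', div_le_iff₀ (by positivity)]
      nlinarith
    have h4 : (L : ℝ) * d' = L * dist x y + L * (ε / (L + 1)) := by rw [hd']; ring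
    linarith

/-! ### Bounds and one-sided derivatives for (P1). -/

/-- The constant `M` is a strict classical supersolution of (P3), so `u` minus its lift cannot
attain its maximum in the half-open cube; on `Γ` that difference is nonpositive. -/
theorem solutionP1_le_expMeanLog {n : ℕ} (hn : n ≠ 0) {f u : EuclideanSpace ℝ (Fin n) → ℝ}
    (hu : IsNondecreasingSolutionP1 f u) {M : ℝ} (hM : 0 ≤ M)
    (hfM : ∀ x ∈ halfOpenCube n, f x < M ^ n) :
    ∀ x ∈ halfOpenCube n, u x ≤ n * expMeanLog x * M := by
  intro x hx
  have hcl : IsCompact (closedCube n) := by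
    have h1 : IsCompact (Set.univ.pi fun _ : Fin n => Set.Icc (0 : ℝ) 1) :=
      isCompact_univ_pi fun _ => isCompact_Icc
    have h2 := (EuclideanSpace.equiv (Fin n) ℝ).symm.toHomeomorph.isCompact_image.2 h1
    convert h2 using 1
    ext x
    constructor
    · intro h
      exact ⟨fun i => x i, fun i _ => h i, rfl⟩
    · rintro ⟨t, ht, rfl⟩ i
      exact ht i trivial
  have hsub : halfOpenCube n ⊆ closedCube n := fun x h i => ⟨(h i).1.le, (h i).2⟩
  -- Not written with `expMeanLog`, which is discontinuous at `Γ` because `Real.log 0 = 0`.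
  set v : EuclideanSpace ℝ (Fin n) → ℝ := fun y => n * (∏ i, y i) ^ (1 / (n : ℝ)) * M with hv
  have hvl : ∀ y ∈ halfOpenCube n, v y = liftTest (fun _ => M) y := fun y hy => by
    rw [hv, liftTest, expMeanLog_eq hy]
  have hvc : Continuous v := by
    refine (continuous_const.mul (Continuous.rpow_const (by fun_prop) fun _ => ?_)).mul
      continuous_const
    exact Or.inr (by positivity)
  obtain ⟨y, hy, hmax⟩ := hcl.exists_isMaxOn ⟨x, hsub hx⟩ (hu.continuousOn.sub hvc.continuousOn)
  have hxy : u x - v x ≤ u y - v y := hmax (hsub hx)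
  have hgoal : u x - v x ≤ 0 → u x ≤ n * expMeanLog x * M := fun h => by
    rw [hvl x hx, liftTest] at h
    linarith
  refine hgoal ?_
  by_cases hyΩ : y ∈ halfOpenCube n
  · exfalso
    have hloc : IsLocalMaxOn (fun x => u x - liftTest (fun _ => M) x) (halfOpenCube n) y := by
      refine IsMaxOn.localize fun x' hx' => ?_
      have h : u x' - v x' ≤ u y - v y := hmax (hsub hx')
      rwa [hvl x' hx', hvl y hyΩ] at h
    have hc : ContDiffAt ℝ 1 (fun _ : EuclideanSpace ℝ (Fin n) => M) y := contDiffAt_const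
    have h := hu.solution.1.2 y hyΩ _ (contDiffAt_liftTest hyΩ hc) hloc
    rw [hamiltonianP1_liftTest hn hyΩ hc] at h
    simp only [hamiltonianP3, partials, fderiv_fun_const, Pi.zero_apply, zero_apply,
      mul_zero, add_zero, max_eq_left hM, Finset.prod_const, Finset.card_univ,
      Fintype.card_fin] at h
    linarith [hfM y hyΩ]
  · have h1 : u y = 0 := hu.boundary y ⟨hy, hyΩ⟩
    have h2 : 0 ≤ v y := mul_nonneg (mul_nonneg (Nat.cast_nonneg n)
      (Real.rpow_nonneg (Finset.prod_nonneg fun i _ => (hy i).1) _)) hM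
    linarith

theorem solutionP1_nonneg {n : ℕ} (hn : n ≠ 0) {f u : EuclideanSpace ℝ (Fin n) → ℝ}
    (hu : IsNondecreasingSolutionP1 f u) : ∀ x ∈ closedCube n, 0 ≤ u x := by
  intro x hx
  have h0 : (0 : EuclideanSpace ℝ (Fin n)) ∈ closedCube n := fun i => by simp
  rw [← hu.boundary 0 ⟨h0, fun h => by simpa using (h ⟨0, Nat.pos_of_ne_zero hn⟩).1⟩]
  exact hu.nondecreasing 0 h0 x hx fun i => by simpa using (hx i).1

/-- Moving from `y` in direction `-e_i` stays in the half-open cube, even when `y i = 1`; there `u`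
does not increase, hence neither does `φ`. -/
theorem partials_nonneg_of_isLocalMinOn {n : ℕ} {u φ : EuclideanSpace ℝ (Fin n) → ℝ}
    (hu : ∀ x ∈ closedCube n, ∀ y ∈ closedCube n, (∀ i, x i ≤ y i) → u x ≤ u y)
    {y : EuclideanSpace ℝ (Fin n)} (hy : y ∈ halfOpenCube n) (hφ : ContDiffAt ℝ 1 φ y)
    (hmin : IsLocalMinOn (fun x => u x - φ x) (halfOpenCube n) y) (i : Fin n) :
    0 ≤ partials φ y i := by
  have hsub : halfOpenCube n ⊆ closedCube n := fun x h i => ⟨(h i).1.le, (h i).2⟩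
  have hcurve : HasDerivAt (fun t : ℝ => y - t • EuclideanSpace.single i (1 : ℝ))
      (-(EuclideanSpace.single i (1 : ℝ))) 0 := by
    simpa using ((hasDerivAt_id (0 : ℝ)).smul_const (EuclideanSpace.single i (1 : ℝ))).const_sub y
  have hd : HasDerivAt (fun t : ℝ => φ (y - t • EuclideanSpace.single i (1 : ℝ)))
      (-partials φ y i) 0 := by
    have h := (hφ.differentiableAt one_ne_zero).hasFDerivAt
    have h2 := HasFDerivAt.comp_hasDerivAt_of_eq (0 : ℝ) h hcurve (by simp)
    simp only [map_neg] at h2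
    exact h2
  have hmem : ∀ᶠ t in nhdsWithin (0 : ℝ) (Set.Ioi 0),
      y - t • EuclideanSpace.single i (1 : ℝ) ∈ halfOpenCube n := by
    filter_upwards [Ioo_mem_nhdsGT (hy i).1] with t ht j
    by_cases hj : j = i
    · subst hj
      simp only [PiLp.sub_apply, PiLp.smul_apply, PiLp.single_apply, smul_eq_mul, if_true, mul_one]
      exact ⟨sub_pos.2 ht.2, by linarith [ht.1, (hy j).2]⟩
    · simpa [hj] using hy j
  have htend : Filter.Tendsto (fun t : ℝ => y - t • EuclideanSpace.single i (1 : ℝ))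
      (nhdsWithin 0 (Set.Ioi 0)) (nhdsWithin y (halfOpenCube n)) := by
    refine tendsto_nhdsWithin_iff.2 ⟨?_, hmem⟩
    have := hcurve.continuousAt.tendsto
    simp only [zero_smul, sub_zero] at this
    exact this.mono_left nhdsWithin_le_nhds
  have hle : ∀ᶠ t in nhdsWithin (0 : ℝ) (Set.Ioi 0),
      φ (y - t • EuclideanSpace.single i (1 : ℝ)) ≤ φ y := by
    filter_upwards [htend.eventually hmin, hmem, self_mem_nhdsWithin] with t h1 h2 h3
    have h4 := hu _ (hsub h2) y (hsub hy) fun j => by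
      by_cases hj : j = i
      · subst hj
        have : (0 : ℝ) < t := h3
        simpa using this.le
      · simp [hj]
    linarith
  have hslope := hd.tendsto_slope.mono_left
    (nhdsWithin_mono (0 : ℝ) fun t (ht : t ∈ Set.Ioi 0) => (ne_of_gt ht : t ≠ 0))
  have h0 := le_of_tendsto hslope (b := 0) (by
    filter_upwards [hle, self_mem_nhdsWithin] with t h1 h2
    have h3 : (0 : ℝ) < t := h2
    simp only [slope, sub_zero, vsub_eq_sub, smul_eq_mul, zero_smul]
    exact mul_nonpos_of_nonneg_of_nonpos (inv_nonneg.2 h3.le) (sub_nonpos.2 h1))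
  linarith

/-! ### Transfer of the viscosity inequalities from (P1) to (P3). -/

theorem partials_add_const {n : ℕ} (φ : EuclideanSpace ℝ (Fin n) → ℝ) (c : ℝ)
    (x : EuclideanSpace ℝ (Fin n)) : partials (fun y => φ y + c) x = partials φ x := by
  funext i
  simp [partials]

section Rescaled

variable {n : ℕ} {f u w : EuclideanSpace ℝ (Fin n) → ℝ}

theorem eq_liftTest_of_eq_div (hn : n ≠ 0)
    (hw : ∀ x ∈ halfOpenCube n, w x = u x / ((n : ℝ) * (∏ i, x i) ^ (1 / (n : ℝ)))) :
    ∀ x ∈ halfOpenCube n, u x = liftTest w x := fun x hx => by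
  have hn' : (n : ℝ) ≠ 0 := Nat.cast_ne_zero.2 hn
  rw [liftTest, hw x hx, ← expMeanLog_eq hx]
  have := (expMeanLog_pos x).ne'
  field_simp

/-- The added constant makes the extremal value 0, so multiplication by a positive nonconstant
weight preserves the extremum; it also makes the test function equal to `w y` at `y`, as (P3)
requires. -/
theorem isLocalMaxOn_liftTest (hwu : ∀ x ∈ halfOpenCube n, u x = liftTest w x)
    {φ : EuclideanSpace ℝ (Fin n) → ℝ} {y : EuclideanSpace ℝ (Fin n)} (hy : y ∈ halfOpenCube n)
    (h : IsLocalMaxOn (fun x => w x - φ x) (halfOpenCube n) y) :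
    IsLocalMaxOn (fun x => u x - liftTest (fun x => φ x + (w y - φ y)) x) (halfOpenCube n) y := by
  filter_upwards [h, self_mem_nhdsWithin] with x hx hxΩ
  rw [hwu x hxΩ, hwu y hy]
  simp only [liftTest]
  have h1 : 0 ≤ n * expMeanLog x := mul_nonneg (Nat.cast_nonneg n) (expMeanLog_pos x).le
  have h2 : n * expMeanLog x * (w x - φ x - (w y - φ y)) ≤ 0 :=
    mul_nonpos_of_nonneg_of_nonpos h1 (sub_nonpos.2 hx)
  linarith

theorem isLocalMinOn_liftTest (hwu : ∀ x ∈ halfOpenCube n, u x = liftTest w x)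
    {φ : EuclideanSpace ℝ (Fin n) → ℝ} {y : EuclideanSpace ℝ (Fin n)} (hy : y ∈ halfOpenCube n)
    (h : IsLocalMinOn (fun x => w x - φ x) (halfOpenCube n) y) :
    IsLocalMinOn (fun x => u x - liftTest (fun x => φ x + (w y - φ y)) x) (halfOpenCube n) y := by
  filter_upwards [h, self_mem_nhdsWithin] with x hx hxΩ
  rw [hwu x hxΩ, hwu y hy]
  simp only [liftTest]
  have h1 : 0 ≤ n * expMeanLog x := mul_nonneg (Nat.cast_nonneg n) (expMeanLog_pos x).le
  have h2 : 0 ≤ n * expMeanLog x * (w x - φ x - (w y - φ y)) :=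
    mul_nonneg h1 (sub_nonneg.2 hx)
  linarith

theorem isViscositySolutionP3_of_liftTest (hn : n ≠ 0) (hu : IsNondecreasingSolutionP1 f u)
    (hwc : ContinuousOn w (halfOpenCube n)) (hwu : ∀ x ∈ halfOpenCube n, u x = liftTest w x) :
    IsViscositySolution (halfOpenCube n) (hamiltonianP3 f) w := by
  obtain ⟨hl, hr⟩ := continuousOn_iff_lower_upperSemicontinuousOn.1 hwc
  refine ⟨⟨hr, fun y hy φ hφ h => ?_⟩, ⟨hl, fun y hy φ hφ h => ?_⟩⟩
  · have hφ' : ContDiffAt ℝ 1 (fun x => φ x + (w y - φ y)) y := hφ.add contDiffAt_const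
    have := hu.solution.1.2 y hy _ (contDiffAt_liftTest hy hφ') (isLocalMaxOn_liftTest hwu hy h)
    rw [hamiltonianP1_liftTest hn hy hφ', partials_add_const] at this
    simpa using this
  · have hφ' : ContDiffAt ℝ 1 (fun x => φ x + (w y - φ y)) y := hφ.add contDiffAt_const
    have := hu.solution.2.2 y hy _ (contDiffAt_liftTest hy hφ') (isLocalMinOn_liftTest hwu hy h)
    rw [hamiltonianP1_liftTest hn hy hφ', partials_add_const] at this
    simpa using this

theorem nonneg_of_isLocalMinOn_rescaled (hn : n ≠ 0)
    (hu : ∀ x ∈ closedCube n, ∀ y ∈ closedCube n, (∀ i, x i ≤ y i) → u x ≤ u y)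
    (hwu : ∀ x ∈ halfOpenCube n, u x = liftTest w x)
    {y : EuclideanSpace ℝ (Fin n)} (hy : y ∈ halfOpenCube n) {ψ : EuclideanSpace ℝ (Fin n) → ℝ}
    (hψ : ContDiffAt ℝ 1 ψ y) (h : IsLocalMinOn (fun x => w x - ψ x) (halfOpenCube n) y)
    (i : Fin n) : 0 ≤ w y + n * y i * partials ψ y i := by
  have hψ' : ContDiffAt ℝ 1 (fun x => ψ x + (w y - ψ y)) y := hψ.add contDiffAt_const
  have := partials_nonneg_of_isLocalMinOn hu hy (contDiffAt_liftTest hy hψ')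
    (isLocalMinOn_liftTest hwu hy h) i
  rw [partials_liftTest hn hy hψ', partials_add_const] at this
  simpa using nonneg_of_mul_nonneg_right this (div_pos (expMeanLog_pos y) (hy i).1)

end Rescaled

/-! ### Lipschitz seminorm and conclusion. -/

theorem exists_forall_lt_pow {n : ℕ} (hn : n ≠ 0) {f : EuclideanSpace ℝ (Fin n) → ℝ}
    (hf : ∀ x ∈ closedCube n, 0 ≤ f x) {K : ℝ≥0}
    (hK : LipschitzOnWith K (fun x => f x ^ (1 / (n : ℝ))) (closedCube n)) :
    ∃ M : ℝ, 0 ≤ M ∧ ∀ x ∈ closedCube n, f x < M ^ n := by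
  have hn' : (n : ℝ) ≠ 0 := Nat.cast_ne_zero.2 hn
  have h0 : (0 : EuclideanSpace ℝ (Fin n)) ∈ closedCube n := fun i => by simp
  have hg0 := Real.rpow_nonneg (hf 0 h0) (1 / (n : ℝ))
  refine ⟨f 0 ^ (1 / (n : ℝ)) + K * Real.sqrt n + 1, by positivity, fun x hx => ?_⟩
  have hd : dist x 0 ≤ Real.sqrt n := by
    rw [EuclideanSpace.dist_eq]
    refine Real.sqrt_le_sqrt ?_
    have : ∑ i, dist (x i) ((0 : EuclideanSpace ℝ (Fin n)) i) ^ 2 ≤ ∑ _i : Fin n, (1 : ℝ) :=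
      Finset.sum_le_sum fun i _ => by
        simp only [PiLp.zero_apply, Real.dist_eq, sub_zero, sq_abs]
        exact pow_le_one₀ (hx i).1 (hx i).2
    simpa using this
  have h1 := hK.dist_le_mul x hx 0 h0
  rw [Real.dist_eq] at h1
  have h2 : (K : ℝ) * dist x 0 ≤ K * Real.sqrt n := by gcongr
  have h3 : f x ^ (1 / (n : ℝ)) < f 0 ^ (1 / (n : ℝ)) + K * Real.sqrt n + 1 := by
    linarith [le_abs_self (f x ^ (1 / (n : ℝ)) - f 0 ^ (1 / (n : ℝ)))]
  calc f x = (f x ^ (1 / (n : ℝ))) ^ n := by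
        rw [← Real.rpow_natCast, ← Real.rpow_mul (hf x hx), one_div_mul_cancel hn', Real.rpow_one]
    _ < _ := pow_lt_pow_left₀ h3 (Real.rpow_nonneg (hf x hx) _) hn

theorem lipSeminorm_le_iff {n : ℕ} {Ω : Set (EuclideanSpace ℝ (Fin n))}
    {g : EuclideanSpace ℝ (Fin n) → ℝ} {K : ℝ≥0} :
    lipSeminorm Ω g ≤ K ↔ LipschitzOnWith K g Ω := by
  simp only [lipSeminorm, iSup_le_iff, LipschitzOnWith]
  refine forall_congr' fun x => forall_congr' fun _ => forall_congr' fun y => forall_congr' fun _ => ?_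
  rcases eq_or_ne x y with rfl | hxy
  · simp
  · exact ENNReal.div_le_iff (edist_pos.2 hxy).ne' (edist_ne_top x y)

theorem mainTheorem8 (n : ℕ) (hn : 1 ≤ n)
    (f : EuclideanSpace ℝ (Fin n) → ℝ)
    (hf : ∀ x ∈ closedCube n, 0 ≤ f x)
    (hLip : ∃ K : ℝ≥0, LipschitzOnWith K (fun x => f x ^ (1 / (n : ℝ))) (closedCube n))
    (u : EuclideanSpace ℝ (Fin n) → ℝ)
    (hu : IsNondecreasingSolutionP1 f u)
    (w : EuclideanSpace ℝ (Fin n) → ℝ)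
    (hw : ∀ x ∈ halfOpenCube n, w x = u x / ((n : ℝ) * (∏ i, x i) ^ (1 / (n : ℝ)))) :
    IsMaximalBoundedSolutionP3 f w ∧
    ∃ W : EuclideanSpace ℝ (Fin n) → ℝ,
      (∀ x ∈ halfOpenCube n, W x = w x) ∧
      (∃ K : ℝ≥0, LipschitzOnWith K W (closedCube n)) ∧
      lipSeminorm (closedCube n) W ≤
        ENNReal.ofReal (Real.sqrt (n : ℝ)) *
          lipSeminorm (closedCube n) (fun x => f x ^ (1 / (n : ℝ))) := by
  have hn0 : n ≠ 0 := Nat.one_le_iff_ne_zero.1 hn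
  have hsub : halfOpenCube n ⊆ closedCube n := fun x h i => ⟨(h i).1.le, (h i).2⟩
  obtain ⟨K, hK⟩ := hLip
  obtain ⟨L, hL⟩ : ∃ L : ℝ≥0,
      lipSeminorm (closedCube n) (fun x => f x ^ (1 / (n : ℝ))) = L :=
    ⟨_, (ENNReal.coe_toNNReal (ne_top_of_le_ne_top ENNReal.coe_ne_top
      (lipSeminorm_le_iff.2 hK))).symm⟩
  have hfL := lipSeminorm_le_iff.1 hL.le
  have hwu := eq_liftTest_of_eq_div hn0 hw
  have hn' : (0 : ℝ) < n := Nat.cast_pos.2 hn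
  have hwc : ContinuousOn w (halfOpenCube n) := by
    have h : ContinuousOn (fun x => u x / (n * expMeanLog x)) (halfOpenCube n) :=
      (hu.continuousOn.mono hsub).div (continuousOn_const.mul fun x hx =>
        (contDiffAt_expMeanLog hx).continuousAt.continuousWithinAt)
        fun x _ => (mul_pos hn' (expMeanLog_pos x)).ne'
    exact h.congr fun x hx => by simp only [hw x hx, expMeanLog_eq hx]
  obtain ⟨M, hM, hfM⟩ := exists_forall_lt_pow hn0 hf hK
  have hbdd : ∀ x ∈ halfOpenCube n, |w x| ≤ M := fun x hx => by
    have hp := mul_pos hn' (expMeanLog_pos x)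
    have h1 := solutionP1_le_expMeanLog hn0 hu hM (fun x hx => hfM x (hsub hx)) x hx
    have h2 := solutionP1_nonneg hn0 hu x (hsub hx)
    rw [hwu x hx, liftTest] at h1 h2
    rw [abs_of_nonneg (nonneg_of_mul_nonneg_right h2 hp)]
    exact le_of_mul_le_mul_left h1 hp
  have hwsol : IsBoundedSolutionP3 f w :=
    ⟨⟨M, hbdd⟩, isViscositySolutionP3_of_liftTest hn0 hu hwc hwu⟩
  have hcomp : ∀ z, IsBoundedSolutionP3 f z → ∀ x ∈ halfOpenCube n, ∀ y ∈ halfOpenCube n,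
      z x - w y ≤ L * dist x y := fun z hz x hx y hy =>
    sub_le_mul_dist hn0 hf hfL hz hwsol (fun y hy ψ hψ h =>
      nonneg_of_isLocalMinOn_rescaled hn0 hu.nondecreasing hwu hy hψ h) hx hy
  refine ⟨⟨hwsol, fun z hz x hx => by simpa using hcomp z hz x hx x hx⟩, ?_⟩
  have hwL : LipschitzOnWith L w (halfOpenCube n) :=
    LipschitzOnWith.of_le_add_mul L fun x hx y hy => by linarith [hcomp w hwsol x hx y hy]
  -- Extension of a real Lipschitz function keeps the constant `L`; the factor `√n ≥ 1` is then pure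
  -- slack.
  obtain ⟨W, hW, hWw⟩ := hwL.extend_real
  refine ⟨W, fun x hx => (hWw hx).symm, ⟨L, hW.lipschitzOnWith⟩, ?_⟩
  rw [hL]
  refine (lipSeminorm_le_iff.2 hW.lipschitzOnWith).trans (le_mul_of_one_le_left zero_le ?_)
  rw [ENNReal.one_le_ofReal, Real.one_le_sqrt]
  exact_mod_cast hn
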